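/- Models. Let $G$ be a graph on the $n$ vertices $\{1,\dots,n\}$ (the identifiers); every vertex initially knows its identifier, the identifiers of its neighbors and its own input. In the LOCAL model, in each round every vertex sends a message of arbitrary size to each of its neighbors. In the Congested Clique, in each round every vertex sends a (possibly different) message of $\lceil\log_2 n\rceil$ bits to each of the $n$ vertices. Vertices have private randomness, and local computation is free. For a vertex $v$ let $E^r(v)=\{uw\in E(G): \mathrm{dist}_G(v,u)\le r \text{ and } \mathrm{dist}_G(v,w)\le r\}$ be the edges of its $r$-hop neighborhood. (1) Opportunistic Routing. There are universal constants $R\in\mathbb N$ and $\kappa>0$ such that for every real $c\ge 1$ and all $n,\Delta,r\in\mathbb N$ with $$\Delta^{2(r+1)}\bigl((r+1)\log\Delta+c\log n\bigr)\le n$$ there is a randomized Congested Clique algorithm with $R$ rounds such that, on every $n$-vertex graph $G$ of maximum degree at most $\Delta$, with probability at least $1-n^{-\kappa c}$ every vertex $v$ learns $E^r(v)$. (Here $\log$ is the natural logarithm, and $\Delta^{2(r+1)}\cdot(\cdots)$ is read as $0$ for $\Delta=0$.) (2) Simulating LOCAL algorithms. For all constants $C,c\in\mathbb R$ and $a,b\in\mathbb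 N$ there is a constant $R$ such that the following holds. Let $r=r(n)$ satisfy $r(n)=o(\log n/\log\log n)$ and suppose that, for all sufficiently large $n$, either $b\le r(n)+1$ (which is automatic if $r(n)\to\infty$) or $r(n)=0$. Then for all sufficiently large $n$ and every $\Delta\in\mathbb N$ with $\Delta\le n^{1/(2r+2)}$, every $r$-round (deterministic or randomized) LOCAL algorithm $\mathcal A$ can be simulated by a randomized Congested Clique algorithm with $R$ rounds on the graphs of maximum degree at most $\Delta$ in which the input of each vertex, together with the random bits that the vertex uses in $\mathcal A$, has size at most $C(\log n)^a(\Delta+1)^b$ bits. That is, each vertex draws the random bits used by $\mathcal A$ and additional independent randomness, and for every such graph, every input and every outcome of the random bits used by $\mathcal A$, with probability at least $1-n^{-c}$ over the additional randomness all vertices output exactly what they output in $\mathcal A$. -/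

import Mathlib

open Filter Asymptotics

/-- Probability of the event `P` when `ω` is drawn uniformly at random from a finite type.
For `Ω = (Fin n → T)` the `n` coordinates are independent and uniform on `T`. -/
noncomputable def uniformProb {Ω : Type} [Fintype Ω] (P : Ω → Prop) : ℝ :=
  (Nat.card {ω : Ω // P ω} : ℝ) / (Fintype.card Ω : ℝ)

/-- The edges of the `r`-hop neighborhood of `v`: the edges `uw` of `G` with
`dist (v, u) ≤ r` and `dist (v, w) ≤ r` (the extended distance is `⊤` between
different components). -/
def hopEdges {n : ℕ} (G : SimpleGraph (Fin n)) (r : ℕ) (v : Fin n) : Set (Sym2 (Fin n)) :=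
  {e | e ∈ G.edgeSet ∧ ∀ u ∈ e, G.edist v u ≤ (r : ℕ∞)}

/-- A (possibly randomized) algorithm of the LOCAL model on `n`-vertex graphs whose vertices carry
the identifiers `Fin n`.  A node starts with its identifier, the identifiers of its neighbors, its
input (a bit string) and `t` private random bits (`t = 0`: a deterministic algorithm).  In every
round it sends one message, of unbounded size, to each neighbor, and updates its state according
to the messages received from its neighbors.  Local computation is unrestricted. -/
structure LocalAlg (n t : ℕ) (Out : Type) where
  State : Type
  Msg : Type
  init : (id : Fin n) → (nbrs : Finset (Fin n)) → (input : List Bool) →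
    (coins : Fin t → Bool) → State
  send : State → (target : Fin n) → Msg
  recv : State → (Fin n → Option Msg) → State
  out : State → Out

namespace LocalAlg

variable {n t : ℕ} {Out : Type}

/-- The states of all nodes after a given number of rounds.  The entry `u` of the mailbox of `v`
is `none` unless `u` is a neighbor of `v`. -/
def states (A : LocalAlg n t Out) (G : SimpleGraph (Fin n)) [DecidableRel G.Adj]
    (x : Fin n → List Bool) (ρ : Fin n → Fin t → Bool) : ℕ → Fin n → A.State
  | 0 => fun v => A.init v (G.neighborFinset v) (x v) (ρ v)
  | k + 1 => fun v =>
      A.recv (A.states G x ρ k v)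
        (fun u => if G.Adj v u then some (A.send (A.states G x ρ k u) v) else none)

/-- The output of every node after `r` rounds. -/
def run (A : LocalAlg n t Out) (r : ℕ) (G : SimpleGraph (Fin n)) [DecidableRel G.Adj]
    (x : Fin n → List Bool) (ρ : Fin n → Fin t → Bool) (v : Fin n) : Out :=
  A.out (A.states G x ρ r v)

end LocalAlg

/-- A randomized Congested Clique algorithm on `n`-vertex input graphs.  A node starts with its
identifier, the identifiers of its neighbors in the input graph, an input from `In` and a private
random sample from `Tape`.  In every round it sends to each of the `n` nodes (whether or not they
are adjacent in the input graph) its own message of `⌈log₂ n⌉` bits, and updates its state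
according to the messages received.  Local computation is unrestricted. -/
structure CliqueAlg (n : ℕ) (In Tape Out : Type) where
  State : Type
  init : (id : Fin n) → (nbrs : Finset (Fin n)) → (input : In) → (tape : Tape) → State
  send : State → (target : Fin n) → (Fin (Nat.clog 2 n) → Bool)
  recv : State → (Fin n → (Fin (Nat.clog 2 n) → Bool)) → State
  out : State → Out

namespace CliqueAlg

variable {n : ℕ} {In Tape Out : Type}

/-- The states of all nodes after a given number of rounds. -/
def states (B : CliqueAlg n In Tape Out) (G : SimpleGraph (Fin n)) [DecidableRel G.Adj]
    (x : Fin n → In) (τ : Fin n → Tape) : ℕ → Fin n → B.State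
  | 0 => fun v => B.init v (G.neighborFinset v) (x v) (τ v)
  | k + 1 => fun v =>
      B.recv (B.states G x τ k v) (fun u => B.send (B.states G x τ k u) v)

/-- The output of every node after `R` rounds. -/
def run (B : CliqueAlg n In Tape Out) (R : ℕ) (G : SimpleGraph (Fin n)) [DecidableRel G.Adj]
    (x : Fin n → In) (τ : Fin n → Tape) (v : Fin n) : Out :=
  B.out (B.states G x τ R v)

end CliqueAlg

/-- There is an `R`-round randomized Congested Clique algorithm after which, on every `n`-vertex
graph of maximum degree at most `Δ`, with probability at least `1 - δ` every vertex knows the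
edges of its `r`-hop neighborhood. -/
def LearnsHopEdges (n Δ r R : ℕ) (δ : ℝ) : Prop :=
  ∃ (Ω : Type) (_ : Fintype Ω) (_ : Nonempty Ω) (B : CliqueAlg n Unit Ω (Set (Sym2 (Fin n)))),
    ∀ (G : SimpleGraph (Fin n)) [DecidableRel G.Adj], G.maxDegree ≤ Δ →
      1 - δ ≤ uniformProb
        (fun ω : Fin n → Ω => ∀ v, B.run R G (fun _ => ()) ω v = hopEdges G r v)

/-- There is an `R`-round randomized Congested Clique algorithm `B` that simulates `r` rounds of
the LOCAL algorithm `A` on all `n`-vertex graphs of maximum degree at most `Δ` in which the input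
and the random bits of every node have total size at most `L`.  Each node of `B` draws the random
bits `ρ v` that `A` uses and a further sample `ω v`; for every value of `ρ`, with probability at
least `1 - δ` over `ω`, all nodes output exactly what they output in `A`. -/
def SimulatesLocal {n t : ℕ} {Out : Type} (A : LocalAlg n t Out) (r Δ : ℕ) (L : ℝ)
    (R : ℕ) (δ : ℝ) : Prop :=
  ∃ (Ω : Type) (_ : Fintype Ω) (_ : Nonempty Ω)
    (B : CliqueAlg n (List Bool) ((Fin t → Bool) × Ω) Out),
    ∀ (G : SimpleGraph (Fin n)) [DecidableRel G.Adj], G.maxDegree ≤ Δ →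
      ∀ x : Fin n → List Bool, (∀ v, ((x v).length + t : ℝ) ≤ L) →
        ∀ ρ : Fin n → Fin t → Bool,
          1 - δ ≤ uniformProb
            (fun ω : Fin n → Ω => ∀ v, B.run R G x (fun u => (ρ u, ω u)) v = A.run r G x ρ v)

/-! Every node splits its knowledge into `M ≥ Δ` records, each holding one neighbor and one input
symbol. For each of the `n` nodes acting as relay, and for each of `K` repetitions, it sends a
random neighbor (its pointer) and a random record, drawn afresh. A relay thus sees a random pointer
graph; for every `v` it follows the pointers from `v` for `r` and for `r + 1` steps and reports to
`v` the endpoints and the records they sent. As `K` is constant, these are two exchanges of `O(log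
n)` bits per pair of nodes, hence constantly many rounds (`CliqueAlg.exists_of_two_rounds`,
`card_packets_le`).

If `u ≠ v` is within distance `r` of `v`, at most `r` correctly chosen pointers lead the walk to `u`
(`exists_pointers`). One trial therefore delivers a given record of `u` to `v` with probability at
least `1 / (Δ ^ r * M)`. The `K * n` trials are independent, and a union bound over the triples
(`v`, `u`, record) bounds the failure probability (`exists_cliqueAlg_of_local`, `failure_le`).

A node holding all records of its `r`-ball may evaluate the target function on any instance
consistent with them: such an instance agrees with the true one on the ball, and both `hopEdges` and
an `r`-round LOCAL output depend on nothing else. For hop edges `M = Δ`; for simulation `M` also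
bounds the input length, and `r = o(log n / log log n)` absorbs the polylogarithmic factors
(`eventually_parameters`). -/

/-! ### Uniform probability on finite types. -/

section UniformProb

variable {α β ι : Type} [Fintype α] [Fintype β] [Fintype ι]

theorem uniformProb_mono {P Q : α → Prop} (h : ∀ a, P a → Q a) :
    uniformProb P ≤ uniformProb Q := by
  unfold uniformProb
  gcongr
  exact Nat.card_le_card_of_injective (Subtype.map id h) (Subtype.map_injective h fun _ _ => id)

theorem uniformProb_nonneg (P : α → Prop) : 0 ≤ uniformProb P := by
  unfold uniformProb; positivity

theorem uniformProb_of_forall [Nonempty α] {P : α → Prop} (h : ∀ a, P a) :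
    uniformProb P = 1 := by
  have : Nat.card {a // P a} = Fintype.card α := by
    rw [Nat.card_congr (Equiv.subtypeUnivEquiv h), Nat.card_eq_fintype_card]
  rw [uniformProb, this, div_self]
  exact_mod_cast Fintype.card_ne_zero

theorem uniformProb_of_forall_not {P : α → Prop} (h : ∀ a, ¬ P a) : uniformProb P = 0 := by
  simp [uniformProb, h]

theorem uniformProb_not [Nonempty α] (P : α → Prop) :
    uniformProb (fun a => ¬ P a) = 1 - uniformProb P := by
  classical
  have h : Nat.card {a // P a} + Nat.card {a // ¬ P a} = Fintype.card α := by
    rw [← Nat.card_sum, Nat.card_congr (Equiv.sumCompl P), Nat.card_eq_fintype_card]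
  have h' : (Fintype.card α : ℝ) ≠ 0 := by exact_mod_cast Fintype.card_ne_zero
  rw [eq_sub_iff_add_eq, uniformProb, uniformProb, ← add_div, div_eq_one_iff_eq h', ← h]
  push_cast
  ring

theorem uniformProb_exists_le (P : ι → α → Prop) :
    uniformProb (fun a => ∃ i, P i a) ≤ ∑ i, uniformProb (P i) := by
  classical
  simp only [uniformProb, ← Finset.sum_div]
  gcongr
  simp only [Nat.card_eq_fintype_card, Fintype.card_subtype]
  have : Finset.univ.filter (fun a => ∃ i, P i a) =
      Finset.univ.biUnion fun i => Finset.univ.filter (P i) := by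
    ext; simp
  rw [this]
  exact_mod_cast Finset.card_biUnion_le

theorem uniformProb_comp_equiv (f : α ≃ β) (P : β → Prop) :
    uniformProb (fun a => P (f a)) = uniformProb P := by
  rw [uniformProb, uniformProb, Fintype.card_congr f,
    Nat.card_congr (f.subtypeEquiv (fun a => Iff.rfl) : {a // P (f a)} ≃ {b // P b})]

theorem uniformProb_pi [DecidableEq ι] (P : ι → α → Prop) :
    uniformProb (fun a : ι → α => ∀ i, P i (a i)) = ∏ i, uniformProb (P i) := by
  simp only [uniformProb, Finset.prod_div_distrib]
  rw [Nat.card_congr Equiv.subtypePiEquivPi, Nat.card_pi, Fintype.card_pi]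
  push_cast
  rfl

theorem uniformProb_prod (P : α → Prop) (Q : β → Prop) :
    uniformProb (fun a : α × β => P a.1 ∧ Q a.2) = uniformProb P * uniformProb Q := by
  simp only [uniformProb]
  rw [Nat.card_congr Equiv.subtypeProdEquivProd, Nat.card_prod, Fintype.card_prod]
  push_cast
  rw [div_mul_div_comm]

theorem uniformProb_eq_apply (b : α) : uniformProb (fun a => a = b) = 1 / Fintype.card α := by
  simp [uniformProb]

/-- The probability that finitely many coordinates of a random function take prescribed values. -/
theorem uniformProb_agree [DecidableEq ι] {Δ M : ℕ} (hΔ : 0 < Δ) (hM : 0 < M)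
    (T : Finset ι) (g : ι → Fin Δ) (u : ι) (i : Fin M) :
    uniformProb (fun h : ι → Fin Δ × Fin M => (∀ z ∈ T, (h z).1 = g z) ∧ (h u).2 = i) =
      1 / ((Δ : ℝ) ^ T.card * M) := by
  have : Nonempty (Fin Δ) := ⟨⟨0, hΔ⟩⟩
  have : Nonempty (Fin M) := ⟨⟨0, hM⟩⟩
  have h1 : (fun h : ι → Fin Δ × Fin M => (∀ z ∈ T, (h z).1 = g z) ∧ (h u).2 = i) =
      fun h => ∀ z, (fun p : Fin Δ × Fin M => (z ∈ T → p.1 = g z) ∧ (z = u → p.2 = i)) (h z) := by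
    funext h
    simp [forall_and]
  have h2 (z : ι) : uniformProb (fun a : Fin Δ => z ∈ T → a = g z) =
      if z ∈ T then 1 / (Δ : ℝ) else 1 := by
    split_ifs with hz
    · simpa [hz] using uniformProb_eq_apply (g z)
    · exact uniformProb_of_forall (by simp [hz])
  have h3 (z : ι) : uniformProb (fun a : Fin M => z = u → a = i) =
      if z = u then 1 / (M : ℝ) else 1 := by
    split_ifs with hz
    · simpa [hz] using uniformProb_eq_apply i
    · exact uniformProb_of_forall (by simp [hz])
  have h4 (z : ι) :
      uniformProb (fun p : Fin Δ × Fin M => (z ∈ T → p.1 = g z) ∧ (z = u → p.2 = i)) =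
        (if z ∈ T then 1 / (Δ : ℝ) else 1) * if z = u then 1 / (M : ℝ) else 1 := by
    rw [← h2, ← h3]
    exact uniformProb_prod (fun a : Fin Δ => z ∈ T → a = g z) (fun a : Fin M => z = u → a = i)
  rw [h1, uniformProb_pi
    (fun (z : ι) (p : Fin Δ × Fin M) => (z ∈ T → p.1 = g z) ∧ (z = u → p.2 = i))]
  simp only [h4, Finset.prod_mul_distrib, Finset.prod_ite_eq', Finset.prod_ite_mem,
    Finset.univ_inter, Finset.prod_const, Finset.mem_univ, if_true]
  rw [one_div_pow, one_div_mul_one_div]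

/-- Independent repetitions: the probability that none of the samples indexed by `κ × ι`
satisfies `S`. -/
theorem uniformProb_forall_not_le {κ : Type} [Fintype κ] [DecidableEq κ] [DecidableEq ι]
    {ζ : Type} [Fintype ζ] [DecidableEq ζ] [Nonempty α] (S : (ζ → α) → Prop) {p : ℝ}
    (hp : p ≤ uniformProb S) :
    uniformProb (fun ω : ζ → κ → ι → α => ∀ k w, ¬ S fun z => ω z k w) ≤
      (1 - p) ^ (Fintype.card κ * Fintype.card ι) := by
  -- Regrouping the coins by trial instead of by node exhibits the trials as independent
  -- coordinates.
  let f : (ζ → κ → ι → α) ≃ (κ × ι → ζ → α) :=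
    { toFun := fun ω q z => ω z q.1 q.2
      invFun := fun τ z k w => τ (k, w) z
      left_inv := fun _ => rfl
      right_inv := fun _ => rfl }
  have h := uniformProb_comp_equiv f (fun τ => ∀ q, ¬ S (τ q))
  have h' : (fun ω : ζ → κ → ι → α => ∀ k w, ¬ S fun z => ω z k w) =
      fun ω => ∀ q, ¬ S (f ω q) := by
    funext ω
    simp [f]
  rw [h', h, uniformProb_pi (fun _ : κ × ι => fun a => ¬ S a), uniformProb_not, Finset.prod_const,
    Finset.card_univ, Fintype.card_prod]
  have h0 : 0 ≤ 1 - uniformProb S := by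
    rw [← uniformProb_not]
    exact uniformProb_nonneg _
  gcongr

end UniformProb

/-! ### Dependence on the `r`-ball only. -/

section Locality

namespace SimpleGraph

variable {V : Type} {G G' : SimpleGraph V} {v u : V}

theorem edist_le_succ_iff {k : ℕ} :
    G.edist v u ≤ (k + 1 : ℕ) ↔ G.edist v u ≤ k ∨ ∃ w, G.edist v w ≤ k ∧ G.Adj w u := by
  constructor
  · intro h
    obtain ⟨p, hp⟩ := exists_walk_of_edist_ne_top (ne_top_of_le_ne_top (ENat.natCast_ne_top _) h)
    cases hq : p.reverse with
    | nil => exact Or.inl (by simp)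
    | @cons _ w _ hadj q =>
      refine Or.inr ⟨w, ?_, hadj.symm⟩
      have h1 : q.length + 1 = p.length := by
        rw [← p.length_reverse, hq, Walk.length_cons]
      have h2 : p.length ≤ k + 1 := by
        rw [← hp] at h
        exact_mod_cast h
      rw [edist_comm]
      refine (edist_le q).trans ?_
      exact_mod_cast (by omega : q.length ≤ k)
  · rintro (h | ⟨w, hw, hadj⟩)
    · exact h.trans (by exact_mod_cast Nat.le_succ k)
    · refine (SimpleGraph.edist_triangle (v := w)).trans ?_
      rw [edist_eq_one_iff_adj.2 hadj]
      push_cast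
      gcongr

theorem exists_adj_edist_eq {d : ℕ} (h : G.edist v u = (d + 1 : ℕ)) :
    ∃ w, G.Adj w u ∧ G.edist v w = d := by
  rcases edist_le_succ_iff.1 h.le with h' | ⟨w, hw, hadj⟩
  · rw [h] at h'
    exact absurd h' (by simp only [Nat.cast_le]; omega)
  · refine ⟨w, hadj, hw.antisymm ?_⟩
    by_contra! hlt
    cases d with
    | zero => simp at hlt
    | succ d =>
      have h1 : G.edist v w ≤ d := by
        apply Order.le_of_lt_add_one
        exact_mod_cast hlt
      have h2 := edist_le_succ_iff.2 (Or.inr ⟨w, h1, hadj⟩)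
      rw [h] at h2
      simp only [Nat.cast_le] at h2
      omega

/-- Two graphs in which the vertices at distance at most `r` from `v` have the same neighbors
have the same balls of radius at most `r` around `v`. -/
theorem edist_le_iff_of_agree {r : ℕ}
    (h : ∀ u, G.edist v u ≤ r → ∀ w, G.Adj u w ↔ G'.Adj u w) {k : ℕ} (hk : k ≤ r) (u : V) :
    G.edist v u ≤ k ↔ G'.edist v u ≤ k := by
  induction k generalizing u with
  | zero => simp
  | succ k ih =>
    rw [edist_le_succ_iff, edist_le_succ_iff, ih (by omega)]
    refine or_congr_right (exists_congr fun w => ?_)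
    rw [ih (by omega)]
    refine and_congr_right fun hw => h w ?_ u
    rw [← ih (by omega)] at hw
    exact hw.trans (by exact_mod_cast (by omega : k ≤ r))

end SimpleGraph

theorem hopEdges_congr {n r : ℕ} {G G' : SimpleGraph (Fin n)} {v : Fin n}
    (h : ∀ u, G.edist v u ≤ r → ∀ w, G.Adj u w ↔ G'.Adj u w) :
    hopEdges G r v = hopEdges G' r v := by
  ext e
  induction e with
  | _ a b =>
    simp only [hopEdges, Set.mem_ofPred_eq, SimpleGraph.mem_edgeSet, Sym2.mem_iff, forall_eq_or_imp,
      forall_eq, ← SimpleGraph.edist_le_iff_of_agree h le_rfl]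
    exact and_congr_left fun hab => h a hab.1 b

/-- Light cone argument: information travels one edge per round, so a step back in time is paid for
by one more unit of distance, keeping `k + l ≤ r`. -/
theorem LocalAlg.states_congr {n t : ℕ} {Out : Type} (A : LocalAlg n t Out) {r : ℕ}
    {G G' : SimpleGraph (Fin n)} [DecidableRel G.Adj] [DecidableRel G'.Adj]
    {x x' : Fin n → List Bool} {ρ ρ' : Fin n → Fin t → Bool} {v : Fin n}
    (hG : ∀ u, G.edist v u ≤ r → ∀ w, G.Adj u w ↔ G'.Adj u w)
    (hx : ∀ u, G.edist v u ≤ r → x u = x' u) (hρ : ∀ u, G.edist v u ≤ r → ρ u = ρ' u)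
    {k l : ℕ} (hkl : k + l ≤ r) {u : Fin n} (hu : G.edist v u ≤ l) :
    A.states G x ρ k u = A.states G' x' ρ' k u := by
  have hr : G.edist v u ≤ r := hu.trans (by exact_mod_cast (by omega : l ≤ r))
  induction k generalizing l u with
  | zero =>
    have : G.neighborFinset u = G'.neighborFinset u := by
      ext w
      simpa using hG u hr w
    simp only [states, this, hx u hr, hρ u hr]
  | succ k ih =>
    simp only [states]
    rw [ih (l := l) (by omega) hu hr]
    congr 1
    funext w
    simp only [hG u hr w]
    split_ifs with hadj
    · have hw : G.edist v w ≤ (l + 1 : ℕ) :=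
        SimpleGraph.edist_le_succ_iff.2 (Or.inr ⟨u, hu, (hG u hr w).2 hadj⟩)
      rw [ih (l := l + 1) (by omega) hw (hw.trans (by exact_mod_cast (by omega : l + 1 ≤ r)))]
    · rfl

theorem LocalAlg.run_congr {n t : ℕ} {Out : Type} (A : LocalAlg n t Out) {r : ℕ}
    {G G' : SimpleGraph (Fin n)} [DecidableRel G.Adj] [DecidableRel G'.Adj]
    {x x' : Fin n → List Bool} {ρ ρ' : Fin n → Fin t → Bool} {v : Fin n}
    (hG : ∀ u, G.edist v u ≤ r → ∀ w, G.Adj u w ↔ G'.Adj u w)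
    (hx : ∀ u, G.edist v u ≤ r → x u = x' u) (hρ : ∀ u, G.edist v u ≤ r → ρ u = ρ' u) :
    A.run r G x ρ v = A.run r G' x' ρ' v := by
  rw [run, run, A.states_congr hG hx hρ (l := 0) le_rfl (by simp)]

end Locality

/-! ### Splitting long messages into Congested Clique rounds. -/

section Clique

/-- An algorithm without communication. -/
theorem CliqueAlg.exists_of_own_data {n : ℕ} {In Tape Out : Type}
    (f : Fin n → Finset (Fin n) → In → Tape → Out) :
    ∃ B : CliqueAlg n In Tape Out, ∀ (R : ℕ) (G : SimpleGraph (Fin n)) [DecidableRel G.Adj]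
      (x : Fin n → In) (τ : Fin n → Tape) (v : Fin n),
      B.run R G x τ v = f v (G.neighborFinset v) (x v) (τ v) := by
  let B : CliqueAlg n In Tape Out :=
    { State := Out
      init := f
      send := fun _ _ _ => false
      recv := fun s _ => s
      out := id }
  refine ⟨B, fun R G _ x τ v => ?_⟩
  change B.states G x τ R v = _
  induction R with
  | zero => rfl
  | succ R ih => exact ih

/-- Two rounds with messages from an alphabet `μ` can be simulated in `2 * k` rounds if the
elements of `μ` can be encoded by `k` messages of the Congested Clique. -/
theorem CliqueAlg.exists_of_two_rounds {n k : ℕ} {In Tape Out μ : Type} [Fintype μ] [Nonempty μ]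
    (hμ : Fintype.card μ ≤ (2 ^ Nat.clog 2 n) ^ k)
    (send₁ : Fin n → Finset (Fin n) → In → Tape → Fin n → μ)
    (send₂ : (Fin n → μ) → Fin n → μ)
    (out : Fin n → Finset (Fin n) → In → (Fin n → μ) → Out) :
    ∃ B : CliqueAlg n In Tape Out, ∀ (G : SimpleGraph (Fin n)) [DecidableRel G.Adj]
      (x : Fin n → In) (τ : Fin n → Tape) (v : Fin n),
      B.run (2 * k) G x τ v = out v (G.neighborFinset v) (x v)
        (fun w => send₂ (fun u => send₁ u (G.neighborFinset u) (x u) (τ u) w) v) := by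
  obtain ⟨enc⟩ : Nonempty (μ ↪ (Fin k → Fin (Nat.clog 2 n) → Bool)) :=
    Function.Embedding.nonempty_of_card_le (by simpa using hμ)
  let word (m : μ) (i : ℕ) : Fin (Nat.clog 2 n) → Bool :=
    if h : i < k then enc m ⟨i, h⟩ else fun _ => false
  let dec (s : ℕ → Fin (Nat.clog 2 n) → Bool) : μ := Function.invFun enc fun i => s i
  have hdec (m : μ) (s : ℕ → Fin (Nat.clog 2 n) → Bool) (h : ∀ i < k, s i = word m i) :
      dec s = m := by
    have : (fun i : Fin k => s i) = enc m := by
      funext i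
      simp [h i i.2, word]
    simp only [dec, this]
    exact Function.leftInverse_invFun enc.injective m
  let B : CliqueAlg n In Tape Out :=
    { State := (Fin n × Finset (Fin n) × In × Tape) × ℕ × (ℕ → Fin n → Fin (Nat.clog 2 n) → Bool)
      init := fun v s x τ => ((v, s, x, τ), 0, fun _ _ _ => false)
      send := fun st w =>
        if st.2.1 < k then word (send₁ st.1.1 st.1.2.1 st.1.2.2.1 st.1.2.2.2 w) st.2.1
        else word (send₂ (fun u => dec fun i => st.2.2 i u) w) (st.2.1 - k)
      recv := fun st m => (st.1, st.2.1 + 1, Function.update st.2.2 st.2.1 m)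
      out := fun st => out st.1.1 st.1.2.1 st.1.2.2.1 fun u => dec fun i => st.2.2 (k + i) u }
  refine ⟨B, fun G _ x τ v => ?_⟩
  have hst (T : ℕ) (v : Fin n) :
      (B.states G x τ T v).1 = (v, G.neighborFinset v, x v, τ v) ∧ (B.states G x τ T v).2.1 = T ∧
        ∀ s < T, ∀ u, (B.states G x τ T v).2.2 s u = B.send (B.states G x τ s u) v := by
    induction T with
    | zero => exact ⟨rfl, rfl, by simp⟩
    | succ T ih =>
      obtain ⟨h1, h2, h3⟩ := ih
      refine ⟨h1, congrArg (· + 1) h2, fun s hs u => ?_⟩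
      change Function.update (B.states G x τ T v).2.2 (B.states G x τ T v).2.1 _ s u = _
      rw [h2]
      rcases (Nat.lt_succ_iff_lt_or_eq.1 hs) with hs | rfl
      · rw [Function.update_of_ne hs.ne, h3 s hs]
      · rw [Function.update_self]
  have hfirst (T : ℕ) (hT : k ≤ T) (w u : Fin n) :
      dec (fun i => (B.states G x τ T w).2.2 i u) =
        send₁ u (G.neighborFinset u) (x u) (τ u) w := by
    refine hdec (send₁ u (G.neighborFinset u) (x u) (τ u) w)
      (fun i => (B.states G x τ T w).2.2 i u) fun i hi => ?_
    rw [(hst T w).2.2 i (hi.trans_le hT) u]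
    simp only [B, (hst i u).1, (hst i u).2.1, hi, if_true]
  have hsecond (w : Fin n) :
      dec (fun i => (B.states G x τ (2 * k) v).2.2 (k + i) w) =
        send₂ (fun u => send₁ u (G.neighborFinset u) (x u) (τ u) w) v := by
    refine hdec (send₂ (fun u => send₁ u (G.neighborFinset u) (x u) (τ u) w) v)
      (fun i => (B.states G x τ (2 * k) v).2.2 (k + i) w) fun i hi => ?_
    rw [(hst (2 * k) v).2.2 (k + i) (by omega) w]
    change (if (B.states G x τ (k + i) w).2.1 < k then _ else _) = _
    rw [(hst (k + i) w).2.1, if_neg (by omega)]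
    simp only [hfirst (k + i) (by omega) w, Nat.add_sub_cancel_left]
    rfl
  have hout : B.run (2 * k) G x τ v = out (B.states G x τ (2 * k) v).1.1
      (B.states G x τ (2 * k) v).1.2.1 (B.states G x τ (2 * k) v).1.2.2.1
      (fun u => dec fun i => (B.states G x τ (2 * k) v).2.2 (k + i) u) := rfl
  rw [hout]
  simp only [(hst (2 * k) v).1, hsecond]

end Clique

/-! ### Random pointers, records and relays. -/

section OpportunisticRouting

/-- The neighbors of a vertex as a finset, without a decidability hypothesis. -/
noncomputable def nbrs {n : ℕ} (G : SimpleGraph (Fin n)) (u : Fin n) : Finset (Fin n) :=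
  (Set.toFinite (G.neighborSet u)).toFinset

@[simp]
theorem mem_nbrs {n : ℕ} {G : SimpleGraph (Fin n)} {u w : Fin n} : w ∈ nbrs G u ↔ G.Adj u w := by
  simp [nbrs]

theorem neighborFinset_eq_nbrs {n : ℕ} (G : SimpleGraph (Fin n)) [DecidableRel G.Adj]
    (u : Fin n) : G.neighborFinset u = nbrs G u := by
  ext
  simp

/-- The `j`-th element of `s`, or `u` if `s` has at most `j` elements. -/
noncomputable def nthNbr {n : ℕ} (u : Fin n) (s : Finset (Fin n)) (j : ℕ) : Fin n :=
  s.toList.getD j u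

theorem exists_nthNbr_eq {n : ℕ} {u w : Fin n} {s : Finset (Fin n)} {m : ℕ} (hw : w ∈ s)
    (hs : s.card ≤ m) : ∃ j < m, nthNbr u s j = w := by
  obtain ⟨j, hj, h⟩ := List.getElem_of_mem (Finset.mem_toList.2 hw)
  refine ⟨j, ?_, ?_⟩
  · rw [Finset.length_toList] at hj
    omega
  · rw [nthNbr, List.getD_eq_getElem _ _ hj, h]

theorem nthNbr_mem_or_eq {n : ℕ} (u : Fin n) (s : Finset (Fin n)) (j : ℕ) :
    nthNbr u s j ∈ s ∨ nthNbr u s j = u := by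
  by_cases hj : j < s.toList.length
  · left
    rw [nthNbr, List.getD_eq_getElem _ _ hj, ← Finset.mem_toList]
    exact List.getElem_mem hj
  · right
    rw [nthNbr, List.getD_eq_default _ _ (by omega)]

/-- The default value `u` is not an element of `s`, so it cannot be mistaken for a neighbor: a list
of `m` entries determines a neighborhood of size at most `m`. -/
theorem mem_of_nthNbr_eq {n m : ℕ} {u w : Fin n} {s s' : Finset (Fin n)} (hu : u ∉ s)
    (hs : s.card ≤ m) (h : ∀ j < m, nthNbr u s j = nthNbr u s' j) (hw : w ∈ s) : w ∈ s' := by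
  obtain ⟨j, hj, rfl⟩ := exists_nthNbr_eq (u := u) hw hs
  rw [h j hj]
  refine (nthNbr_mem_or_eq u s' j).resolve_right fun h' => hu ?_
  rwa [h j hj, h'] at hw

/-- Some vertices of a shortest path can be told which neighbor to point to such that the walk
from `v` that follows the pointers is at `u` after `r` or `r + 1` steps. -/
theorem exists_pointers {n Δ r : ℕ} {G : SimpleGraph (Fin n)} (hΔ : 0 < Δ)
    (hG : ∀ u, (nbrs G u).card ≤ Δ) {v u : Fin n} (hvu : v ≠ u) (hr : G.edist v u ≤ (r : ℕ∞)) :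
    ∃ T : Finset (Fin n), T.card ≤ r ∧ ∃ g : Fin n → Fin Δ, ∀ h : Fin n → Fin Δ,
      (∀ z ∈ T, h z = g z) →
        ∃ b : Bool, (fun z => nthNbr z (nbrs G z) (h z))^[r + b.toNat] v = u := by
  have hpoint {z w : Fin n} (hzw : G.Adj z w) : ∃ j : Fin Δ, nthNbr z (nbrs G z) j = w := by
    obtain ⟨j, hj, h⟩ := exists_nthNbr_eq (u := z) (mem_nbrs.2 hzw) (hG z)
    exact ⟨⟨j, hj⟩, h⟩
  -- The vertices of `T` lie strictly closer to `v` than `d`, so a pointer prescribed later at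
  -- distance `d` or more never overwrites an earlier one.
  have hpath (d : ℕ) : ∀ u, G.edist v u = d → ∃ T : Finset (Fin n), T.card ≤ d ∧
      (∀ z ∈ T, G.edist v z < d) ∧ ∃ g : Fin n → Fin Δ, ∀ h : Fin n → Fin Δ,
        (∀ z ∈ T, h z = g z) → (fun z => nthNbr z (nbrs G z) (h z))^[d] v = u := by
    induction d with
    | zero =>
      intro u hu
      exact ⟨∅, by simp, by simp, fun _ => ⟨0, hΔ⟩, fun _ _ => by simpa using hu⟩
    | succ d ih =>
      intro u hu
      obtain ⟨w, hwu, hw⟩ := SimpleGraph.exists_adj_edist_eq hu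
      obtain ⟨j, hj⟩ := hpoint hwu
      obtain ⟨T, hT, hTd, g, hg⟩ := ih w hw
      have hlt : (d : ℕ∞) < (d + 1 : ℕ) := by exact_mod_cast Nat.lt_succ_self d
      refine ⟨insert w T, (Finset.card_insert_le _ _).trans (by omega), ?_,
        Function.update g w j, fun h hh => ?_⟩
      · intro z hz
        rcases Finset.mem_insert.1 hz with rfl | hz
        · exact hw.trans_lt hlt
        · exact (hTd z hz).trans hlt
      · rw [Function.iterate_succ_apply', hg h, hh w (by simp), Function.update_self, hj]
        intro z hz
        rw [hh z (Finset.mem_insert_of_mem hz), Function.update_of_ne]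
        rintro rfl
        exact (hTd z hz).ne hw
  obtain ⟨d, hd⟩ := ENat.ne_top_iff_exists.1 (ne_top_of_le_ne_top (ENat.natCast_ne_top r) hr)
  have hdr : d ≤ r := by
    rw [← hd] at hr
    exact_mod_cast hr
  -- For `d < r` the walk must not leave `u` for good: `u` points back to its predecessor `w`, and
  -- the walk alternates between them. This costs `(d - 1) + 2 ≤ r` pointers.
  rcases hdr.eq_or_lt with rfl | hlt
  · obtain ⟨T, hT, -, g, hg⟩ := hpath d u hd.symm
    exact ⟨T, hT, g, fun h hh => ⟨false, by simpa using hg h hh⟩⟩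
  obtain ⟨e, rfl⟩ : ∃ e, d = e + 1 := by
    refine Nat.exists_eq_succ_of_ne_zero ?_
    rintro rfl
    exact hvu (SimpleGraph.edist_eq_zero_iff.1 hd.symm)
  obtain ⟨w, hwu, hw⟩ := SimpleGraph.exists_adj_edist_eq hd.symm
  obtain ⟨T, hT, hTd, g, hg⟩ := hpath e w hw
  obtain ⟨i, hi⟩ := hpoint hwu
  obtain ⟨j, hj⟩ := hpoint hwu.symm
  refine ⟨insert u (insert w T), ?_, Function.update (Function.update g w i) u j, fun h hh => ?_⟩
  · have h1 := Finset.card_insert_le u (insert w T)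
    have h2 := Finset.card_insert_le w T
    omega
  set f : Fin n → Fin n := fun z => nthNbr z (nbrs G z) (h z) with hf
  have hfu : f u = w := by
    simp only [hf]
    rw [hh u (by simp), Function.update_self, hj]
  have hfw : f w = u := by
    simp only [hf]
    rw [hh w (by simp), Function.update_of_ne hwu.ne, Function.update_self, hi]
  have hfe : f^[e] v = w := by
    refine hg h fun z hz => ?_
    have hze := hTd z hz
    rw [hh z (by simp [hz]), Function.update_of_ne, Function.update_of_ne]
    · rintro rfl
      exact hze.ne hw
    · rintro rfl
      rw [← hd] at hze
      have : e + 1 < e := by exact_mod_cast hze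
      omega
  -- The alternating walk is at `u` at every second step, so parity decides between `r` and `r + 1`
  -- steps.
  obtain ⟨m, b, hmb⟩ : ∃ (m : ℕ) (b : Bool), r + b.toNat = 2 * m + (1 + e) := by
    rcases Nat.even_or_odd' (r - (1 + e)) with ⟨m, hm | hm⟩
    · exact ⟨m, false, by simp; omega⟩
    · exact ⟨m + 1, true, by simp; omega⟩
  refine ⟨b, ?_⟩
  rw [hmb, Function.iterate_add_apply, Function.iterate_add_apply, hfe, Function.iterate_one, hfw,
    Function.iterate_mul]
  exact Function.iterate_fixed (by simp [hfu, hfw]) m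

/-- The `i`-th record of a vertex: its `i`-th neighbor and the `i`-th symbol of its input. -/
noncomputable def record {n M : ℕ} {In D : Type} (e : In → Fin M → D) (u : Fin n)
    (s : Finset (Fin n)) (x : In) (i : Fin M) : Fin M × Fin n × D :=
  (i, nthNbr u s i, e x i)

/-- The node `v` outputs the value of `Φ` for some instance that is consistent with the records
it knows. -/
noncomputable def consistentOutput {n M : ℕ} {In D Out : Type} (Δ : ℕ) (e : In → Fin M → D)
    (adm : Set In) (Φ : SimpleGraph (Fin n) → (Fin n → In) → Fin n → Out) (v : Fin n) (x₀ : In)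
    (F : Set (Fin n × Fin M × Fin n × D)) : Out := by
  classical
  exact
  if h : ∃ I : SimpleGraph (Fin n) × (Fin n → In), (∀ u, (nbrs I.1 u).card ≤ Δ) ∧
      (∀ u, I.2 u ∈ adm) ∧ ∀ q ∈ F, ∃ i, q.2 = record e q.1 (nbrs I.1 q.1) (I.2 q.1) i
  then Φ h.choose.1 h.choose.2 v else Φ ⊥ (fun _ => x₀) v

variable {n Δ r M K k : ℕ} {In D Out : Type}

/-- The true instance is itself consistent, so the choice is not vacuous. Each record carries its
index, so a record of `u` can only be matched by the record with the same index in the chosen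
instance; hence the two agree on the ball. -/
theorem consistentOutput_eq {e : In → Fin M → D} {adm : Set In} (he : Set.InjOn e adm)
    (hM : Δ ≤ M) {Φ : SimpleGraph (Fin n) → (Fin n → In) → Fin n → Out}
    (hΦ : ∀ G G' x x' v, (∀ u, G.edist v u ≤ (r : ℕ∞) → ∀ w, G.Adj u w ↔ G'.Adj u w) →
      (∀ u, G.edist v u ≤ (r : ℕ∞) → x u = x' u) → Φ G x v = Φ G' x' v)
    {G : SimpleGraph (Fin n)} (hG : ∀ u, (nbrs G u).card ≤ Δ) {x : Fin n → In}
    (hx : ∀ u, x u ∈ adm) (v : Fin n) (x₀ : In) {F : Set (Fin n × Fin M × Fin n × D)}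
    (hsound : ∀ q ∈ F, ∃ i, q.2 = record e q.1 (nbrs G q.1) (x q.1) i)
    (hcomplete : ∀ u, G.edist v u ≤ (r : ℕ∞) → ∀ i, (u, record e u (nbrs G u) (x u) i) ∈ F) :
    consistentOutput Δ e adm Φ v x₀ F = Φ G x v := by
  have hex : ∃ I : SimpleGraph (Fin n) × (Fin n → In), (∀ u, (nbrs I.1 u).card ≤ Δ) ∧
      (∀ u, I.2 u ∈ adm) ∧ ∀ q ∈ F, ∃ i, q.2 = record e q.1 (nbrs I.1 q.1) (I.2 q.1) i :=
    ⟨(G, x), hG, hx, hsound⟩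
  rw [consistentOutput, dif_pos hex]
  obtain ⟨h1, h2, h3⟩ := hex.choose_spec
  set I := hex.choose
  have key (u : Fin n) (hu : G.edist v u ≤ r) (i : Fin M) :
      nthNbr u (nbrs G u) i = nthNbr u (nbrs I.1 u) i ∧ e (x u) i = e (I.2 u) i := by
    obtain ⟨i', hi'⟩ := h3 _ (hcomplete u hu i)
    simp only [record, Prod.mk.injEq] at hi'
    obtain ⟨rfl, h⟩ := hi'
    exact h
  symm
  refine hΦ _ _ _ _ _ (fun u hu w => ?_) fun u hu =>
    he (hx u) (h2 u) (funext fun i => (key u hu i).2)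
  rw [← mem_nbrs, ← mem_nbrs]
  constructor
  · exact mem_of_nthNbr_eq (m := M) (by simp) ((hG u).trans hM) fun j hj => (key u hu ⟨j, hj⟩).1
  · exact mem_of_nthNbr_eq (m := M) (by simp) ((h1 u).trans hM)
      fun j hj => (key u hu ⟨j, hj⟩).1.symm

/-- Opportunistic routing: every function of the `r`-hop neighborhoods and of the inputs therein
is computed by a Congested Clique algorithm in which every node reveals to every relay `K` random
neighbors and `K` random records. -/
theorem exists_cliqueAlg_of_local [Fintype D] [Nonempty D] (hn : 0 < n) (hΔ : 0 < Δ) (hM : Δ ≤ M)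
    {e : In → Fin M → D} {adm : Set In} (he : Set.InjOn e adm)
    {Φ : SimpleGraph (Fin n) → (Fin n → In) → Fin n → Out}
    (hΦ : ∀ G G' x x' v, (∀ u, G.edist v u ≤ (r : ℕ∞) → ∀ w, G.Adj u w ↔ G'.Adj u w) →
      (∀ u, G.edist v u ≤ (r : ℕ∞) → x u = x' u) → Φ G x v = Φ G' x' v)
    (hk : Fintype.card (Fin K × Bool → Fin n × Fin M × Fin n × D) ≤ (2 ^ Nat.clog 2 n) ^ k) :
    ∃ B : CliqueAlg n In (Fin K → Fin n → Fin Δ × Fin M) Out,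
      ∀ (G : SimpleGraph (Fin n)) [DecidableRel G.Adj], G.maxDegree ≤ Δ →
        ∀ x : Fin n → In, (∀ v, x v ∈ adm) →
          1 - (n : ℝ) ^ 2 * M * (1 - 1 / ((Δ : ℝ) ^ r * M)) ^ (K * n) ≤
            uniformProb (fun ω : Fin n → Fin K → Fin n → Fin Δ × Fin M =>
              ∀ v, B.run (2 * k) G x ω v = Φ G x v) := by
  have : Nonempty (Fin n) := ⟨⟨0, hn⟩⟩
  have : Nonempty (Fin Δ) := ⟨⟨0, hΔ⟩⟩
  have : Nonempty (Fin M) := ⟨⟨0, hΔ.trans_le hM⟩⟩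
  obtain ⟨B, hB⟩ := CliqueAlg.exists_of_two_rounds (Tape := Fin K → Fin n → Fin Δ × Fin M) hk
    (fun u s x τ w p => (nthNbr u s (τ p.1 w).1, record e u s x (τ p.1 w).2))
    (fun m v p =>
      -- The relay reads pointers from the copy with flag `false`; the flag of `p` only selects the
      -- walk length.
      let y := (fun z => (m z (p.1, false)).1)^[r + p.2.toNat] v
      (y, (m y (p.1, false)).2))
    (fun v s x m => consistentOutput Δ e adm Φ v x
      -- The own records of `v` are added by hand, since `exists_pointers` requires `v ≠ u`.
      (Set.range (fun wp : Fin n × Fin K × Bool => m wp.1 wp.2) ∪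
        Set.range fun i => (v, record e v s x i)))
  refine ⟨B, fun G _ hG x hx => ?_⟩
  have hdeg (u : Fin n) : (nbrs G u).card ≤ Δ := by
    rw [← neighborFinset_eq_nbrs, SimpleGraph.card_neighborFinset_eq_degree]
    exact (G.degree_le_maxDegree u).trans hG
  let walk (h : Fin n → Fin Δ × Fin M) (v : Fin n) (b : Bool) : Fin n :=
    (fun z => nthNbr z (nbrs G z) (h z).1)^[r + b.toNat] v
  let hit (q : Fin n × Fin n × Fin M) (h : Fin n → Fin Δ × Fin M) : Prop :=
    ∃ b, walk h q.1 b = q.2.1 ∧ (h q.2.1).2 = q.2.2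
  let bad (q : Fin n × Fin n × Fin M) (ω : Fin n → Fin K → Fin n → Fin Δ × Fin M) : Prop :=
    (q.1 ≠ q.2.1 ∧ G.edist q.1 q.2.1 ≤ r) ∧ ∀ j w, ¬ hit q fun z => ω z j w
  have hbad (q : Fin n × Fin n × Fin M) :
      uniformProb (bad q) ≤ (1 - 1 / ((Δ : ℝ) ^ r * M)) ^ (K * n) := by
    by_cases hq : q.1 ≠ q.2.1 ∧ G.edist q.1 q.2.1 ≤ r
    · obtain ⟨T, hT, g, hg⟩ := exists_pointers hΔ hdeg hq.1 hq.2
      have hp : 1 / ((Δ : ℝ) ^ r * M) ≤ uniformProb (hit q) := by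
        calc 1 / ((Δ : ℝ) ^ r * M) ≤ 1 / ((Δ : ℝ) ^ T.card * M) := by
              have h1 : (1 : ℝ) ≤ Δ := by exact_mod_cast hΔ
              have h2 : (0 : ℝ) < M := by exact_mod_cast hΔ.trans_le hM
              gcongr
          _ = _ := (uniformProb_agree hΔ (hΔ.trans_le hM) T g q.2.1 q.2.2).symm
          _ ≤ _ := uniformProb_mono fun h hh => by
            obtain ⟨b, hb⟩ := hg (fun z => (h z).1) hh.1
            exact ⟨b, hb, hh.2⟩
      refine (uniformProb_mono fun ω hω => hω.2).trans ?_
      simpa using uniformProb_forall_not_le (κ := Fin K) (ι := Fin n) (ζ := Fin n) (hit q) hp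
    · refine (uniformProb_of_forall_not fun ω hω => hq hω.1).trans_le ?_
      have h1 : 1 / ((Δ : ℝ) ^ r * M) ≤ 1 := by
        apply div_le_one_of_le₀ _ (by positivity)
        exact_mod_cast Nat.mul_pos (Nat.pow_pos hΔ) (hΔ.trans_le hM)
      exact pow_nonneg (by linarith) _
  have hgood (ω : Fin n → Fin K → Fin n → Fin Δ × Fin M) (hω : ¬ ∃ q, bad q ω) (v : Fin n) :
      B.run (2 * k) G x ω v = Φ G x v := by
    rw [hB]
    simp only [neighborFinset_eq_nbrs]
    refine consistentOutput_eq he hM hΦ hdeg hx v (x v) ?_ ?_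
    · rintro q (⟨⟨w, j, b⟩, rfl⟩ | ⟨i, rfl⟩)
      · exact ⟨_, rfl⟩
      · exact ⟨i, rfl⟩
    · intro u hu i
      by_cases hvu : v = u
      · subst hvu
        exact Or.inr ⟨i, rfl⟩
      · left
        have h : ¬ bad (v, u, i) ω := fun h => hω ⟨_, h⟩
        simp only [bad, not_and, not_forall, not_not] at h
        obtain ⟨j, w, b, hb, hi⟩ := h ⟨hvu, hu⟩
        refine ⟨(w, j, b), ?_⟩
        simp only [walk] at hb hi
        simp only [hb, hi]
  calc 1 - (n : ℝ) ^ 2 * M * (1 - 1 / ((Δ : ℝ) ^ r * M)) ^ (K * n)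
      ≤ 1 - uniformProb (fun ω => ∃ q, bad q ω) := by
        gcongr
        -- Union bound over the `n ^ 2 * M` triples `q`.
        refine (uniformProb_exists_le bad).trans ((Finset.sum_le_sum fun q _ => hbad q).trans ?_)
        simp [sq, mul_assoc]
    _ = uniformProb (fun ω => ¬ ∃ q, bad q ω) := (uniformProb_not _).symm
    _ ≤ _ := uniformProb_mono hgood

end OpportunisticRouting

/-! ### Message length and failure probability. -/

section Parameters

theorem card_packets_le {n M K : ℕ} {D : Type} [Fintype D] (hn : 2 ≤ n) (hM : M ≤ n)
    (hD : Fintype.card D ≤ 16) :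
    Fintype.card (Fin K × Bool → Fin n × Fin M × Fin n × D) ≤ (2 ^ Nat.clog 2 n) ^ (14 * K) := by
  have h1 : n ≤ 2 ^ Nat.clog 2 n := Nat.le_pow_clog (by norm_num) n
  set N := 2 ^ Nat.clog 2 n
  have h16 : (16 : ℕ) ≤ N ^ 4 :=
    calc 16 = 2 ^ 4 := by norm_num
      _ ≤ N ^ 4 := Nat.pow_le_pow_left (hn.trans h1) 4
  simp only [Fintype.card_fun, Fintype.card_prod, Fintype.card_fin, Fintype.card_bool]
  calc (n * (M * (n * Fintype.card D))) ^ (K * 2) ≤ (N * (N * (N * N ^ 4))) ^ (K * 2) := by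
        gcongr
        · exact hM.trans h1
        · exact hD.trans h16
    _ = N ^ (14 * K) := by ring

/-- Since `1 - x ≤ exp (-x)`, the missed trials contribute `n ^ (-(3 + c))`; the `3` pays for the at
most `n ^ 3` triples of the union bound. -/
theorem failure_le {n Δ r M K : ℕ} {c : ℝ} (hn : 0 < n) (hΔ : 0 < Δ) (hM : 0 < M) (hMn : M ≤ n)
    (h : (3 + c) * Real.log n * ((Δ : ℝ) ^ r * M) ≤ K * n) :
    (n : ℝ) ^ 2 * M * (1 - 1 / ((Δ : ℝ) ^ r * M)) ^ (K * n) ≤ (n : ℝ) ^ (-c) := by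
  have hn' : (0 : ℝ) < n := by exact_mod_cast hn
  have hD : (1 : ℝ) ≤ (Δ : ℝ) ^ r * M := by
    exact_mod_cast Nat.mul_pos (Nat.pow_pos hΔ) hM
  set q := (Δ : ℝ) ^ r * M
  have h1 : 0 ≤ 1 - 1 / q := by
    rw [sub_nonneg]
    exact div_le_one_of_le₀ hD (by positivity)
  have h2 : (1 - 1 / q) ^ (K * n) ≤ (n : ℝ) ^ (-(3 + c)) := by
    calc (1 - 1 / q) ^ (K * n) ≤ Real.exp (-(1 / q)) ^ (K * n) := by
          gcongr
          exact Real.one_sub_le_exp_neg _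
      _ = Real.exp (-(K * n / q)) := by
          rw [← Real.exp_nat_mul]
          congr 1
          push_cast
          ring
      _ ≤ Real.exp (Real.log n * -(3 + c)) := by
          gcongr
          rw [mul_neg, neg_le_neg_iff, le_div_iff₀ (by positivity)]
          linarith
      _ = _ := (Real.rpow_def_of_pos hn' _).symm
  calc (n : ℝ) ^ 2 * M * (1 - 1 / q) ^ (K * n) ≤ (n : ℝ) ^ 2 * n * (n : ℝ) ^ (-(3 + c)) := by
        gcongr
    _ = (n : ℝ) ^ (3 : ℝ) * (n : ℝ) ^ (-(3 + c)) := by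
        norm_cast
    _ = (n : ℝ) ^ (-c) := by
        rw [← Real.rpow_add hn']
        congr 1
        ring

end Parameters

/-! ### Learning the hop edges. -/

theorem learnsHopEdges_of_le {c : ℝ} (hc : 1 ≤ c) {n Δ r : ℕ}
    (h : (Δ : ℝ) ^ (2 * (r + 1)) * (((r : ℝ) + 1) * Real.log Δ + c * Real.log n) ≤ n) :
    LearnsHopEdges n Δ r 112 ((n : ℝ) ^ (-c)) := by
  -- In both cases the graph has no edges, so the empty set is the right output.
  by_cases hedge : n ≤ 1 ∨ Δ = 0
  · obtain ⟨B, hB⟩ := CliqueAlg.exists_of_own_data (n := n) (In := Unit) (Tape := Unit)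
      (Out := Set (Sym2 (Fin n))) fun _ _ _ _ => ∅
    refine ⟨Unit, inferInstance, inferInstance, B, fun G _ hG => ?_⟩
    rw [uniformProb_of_forall]
    · have : (0 : ℝ) ≤ (n : ℝ) ^ (-c) := by positivity
      linarith
    · intro ω v
      rw [hB, eq_comm, Set.eq_empty_iff_forall_notMem]
      rintro e ⟨he, -⟩
      induction e with
      | _ u w =>
        rw [SimpleGraph.mem_edgeSet] at he
        rcases hedge with hn | rfl
        · have : Subsingleton (Fin n) := Fin.subsingleton_iff_le_one.2 hn
          exact he.ne (Subsingleton.elim _ _)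
        · have h1 := (G.degree_le_maxDegree u).trans hG
          rw [← SimpleGraph.card_neighborFinset_eq_degree, Nat.le_zero,
            Finset.card_eq_zero] at h1
          have h2 : w ∈ G.neighborFinset u := by simpa using he
          simp [h1] at h2
  · push Not at hedge
    obtain ⟨hn, hΔ⟩ := hedge
    have hΔ : 0 < Δ := Nat.pos_of_ne_zero hΔ
    have hΔ' : (1 : ℝ) ≤ Δ := by exact_mod_cast hΔ
    have hn' : (2 : ℝ) ≤ n := by exact_mod_cast hn
    have hlog : 1 / 2 < Real.log n :=
      lt_of_lt_of_le (by linarith [Real.log_two_gt_d9]) (Real.log_le_log (by norm_num) hn')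
    have hlogΔ : 0 ≤ Real.log Δ := Real.log_nonneg hΔ'
    have h1 : (Δ : ℝ) ^ (2 * (r + 1)) * (c * Real.log n) ≤ n := by
      refine le_trans ?_ h
      gcongr
      have : 0 ≤ ((r : ℝ) + 1) * Real.log Δ := by positivity
      linarith
    have hΔn : Δ ≤ n := by
      by_contra! hlt
      have h2 : (2 : ℝ) * Δ ≤ (Δ : ℝ) ^ (2 * (r + 1)) := by
        calc (2 : ℝ) * Δ ≤ Δ * Δ := by
              gcongr
              exact hn'.trans (by exact_mod_cast hlt.le)
          _ = (Δ : ℝ) ^ 2 := (sq _).symm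
          _ ≤ _ := pow_le_pow_right₀ hΔ' (by omega)
      have h3 : 1 / 2 ≤ c * Real.log n := by nlinarith
      have h4 : (2 : ℝ) * Δ * (1 / 2) ≤ n := le_trans (by gcongr) h1
      have h5 : (n : ℝ) < Δ := by exact_mod_cast hlt
      linarith
    -- Four repetitions suffice because `3 + c ≤ 4 * c`; then `k = 14 * 4`, and the two exchanges
    -- take `2 * 56 = 112` rounds.
    obtain ⟨B, hB⟩ := exists_cliqueAlg_of_local (n := n) (Δ := Δ) (r := r) (M := Δ) (K := 4)
      (k := 56) (In := Unit) (D := Unit) (by omega) hΔ le_rfl (e := fun _ _ => ())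
      (adm := Set.univ) (fun _ _ _ _ _ => rfl) (Φ := fun G _ v => hopEdges G r v)
      (fun G G' x x' v hG _ => hopEdges_congr hG) (card_packets_le hn hΔn (by simp))
    have : Nonempty (Fin Δ) := ⟨⟨0, hΔ⟩⟩
    refine ⟨Fin 4 → Fin n → Fin Δ × Fin Δ, inferInstance, inferInstance, B, fun G _ hG => ?_⟩
    refine le_trans ?_ (hB G hG (fun _ => ()) (by simp))
    gcongr
    refine failure_le (by omega) hΔ hΔ hΔn ?_
    rw [← pow_succ]
    calc (3 + c) * Real.log n * (Δ : ℝ) ^ (r + 1)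
        ≤ (4 * c) * Real.log n * (Δ : ℝ) ^ (2 * (r + 1)) := by
          gcongr
          · linarith
          · omega
      _ = 4 * ((Δ : ℝ) ^ (2 * (r + 1)) * (c * Real.log n)) := by ring
      _ ≤ ((4 : ℕ) : ℝ) * n := by
          push_cast
          gcongr

/-! ### Simulating LOCAL algorithms. -/

section Simulation

variable {n t : ℕ} {In Out : Type}

/-- Random bits that are part of the input may be moved to the random tape. -/
theorem CliqueAlg.exists_of_coins {S Ω : Type} (B : CliqueAlg n (In × S) Ω Out) :
    ∃ B' : CliqueAlg n In (S × Ω) Out, ∀ (R : ℕ) (G : SimpleGraph (Fin n)) [DecidableRel G.Adj]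
      (x : Fin n → In) (ρ : Fin n → S) (ω : Fin n → Ω) (v : Fin n),
      B'.run R G x (fun u => (ρ u, ω u)) v = B.run R G (fun u => (x u, ρ u)) ω v := by
  let B' : CliqueAlg n In (S × Ω) Out :=
    { State := B.State
      init := fun v s x τ => B.init v s (x, τ.1) τ.2
      send := B.send
      recv := B.recv
      out := B.out }
  refine ⟨B', fun R G _ x ρ ω v => ?_⟩
  have h (R : ℕ) : B'.states G x (fun u => (ρ u, ω u)) R =
      B.states G (fun u => (x u, ρ u)) ω R := by
    induction R with
    | zero => rfl
    | succ R ih =>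
      funext v
      change B.recv (B'.states G x _ R v) (fun u => B.send (B'.states G x _ R u) v) = _
      rw [ih]
      rfl
  change B.out (B'.states G x _ R v) = _
  rw [h]
  rfl

/-- The `i`-th bits of the input and of the random string of a node. -/
def inputSymbol (M : ℕ) (x : List Bool × (Fin t → Bool)) (i : Fin M) : Option Bool × Option Bool :=
  (x.1[(i : ℕ)]?, if h : (i : ℕ) < t then some (x.2 ⟨i, h⟩) else none)

/-- The symbol `none` marks the end of the input, so equal symbols force equal lengths as well as
equal bits. -/
theorem inputSymbol_injOn (M : ℕ) :
    Set.InjOn (inputSymbol M) {x : List Bool × (Fin t → Bool) | x.1.length + t ≤ M} := by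
  rintro ⟨l, ρ⟩ hl ⟨l', ρ'⟩ hl' h
  simp only [Set.mem_ofPred_eq] at hl hl'
  have key (i : ℕ) (hi : i < M) := congrFun h ⟨i, hi⟩
  simp only [inputSymbol, Prod.mk.injEq] at key
  refine Prod.ext (List.ext_getElem? fun i => ?_) (funext fun i => ?_)
  · by_cases hi : i < M
    · exact (key i hi).1
    · rw [List.getElem?_eq_none (by simp only; omega), List.getElem?_eq_none (by simp only; omega)]
  · simpa using (key i (by omega)).2

theorem simulatesLocal_zero (A : LocalAlg n t Out) (Δ : ℕ) (L : ℝ) (R : ℕ) {δ : ℝ} (hδ : 0 ≤ δ) :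
    SimulatesLocal A 0 Δ L R δ := by
  obtain ⟨B, hB⟩ := CliqueAlg.exists_of_own_data (n := n) (In := List Bool)
    (Tape := (Fin t → Bool) × Unit) fun v s x τ => A.out (A.init v s x τ.1)
  refine ⟨Unit, inferInstance, inferInstance, B, fun G _ _ x _ ρ => ?_⟩
  rw [uniformProb_of_forall]
  · linarith
  · intro ω v
    rw [hB]
    rfl

theorem simulatesLocal_of_le (A : LocalAlg n t Out) {Δ Δ' r M : ℕ} {L c : ℝ} (hn : 2 ≤ n)
    (hΔ : 0 < Δ') (hΔΔ : Δ ≤ Δ') (hM : Δ' ≤ M) (hMn : M ≤ n) (hL : L ≤ M)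
    (h : (3 + c) * Real.log n * ((Δ' : ℝ) ^ r * M) ≤ n) :
    SimulatesLocal A r Δ L 28 ((n : ℝ) ^ (-c)) := by
  classical
  obtain ⟨B, hB⟩ := exists_cliqueAlg_of_local (n := n) (Δ := Δ') (r := r) (M := M) (K := 1)
    (k := 14) (In := List Bool × (Fin t → Bool)) (D := Option Bool × Option Bool) (by omega) hΔ hM
    (inputSymbol_injOn M)
    (Φ := fun G x v => A.run r G (fun u => (x u).1) (fun u => (x u).2) v)
    (fun G G' x x' v hG hx => A.run_congr hG (fun u hu => congrArg Prod.fst (hx u hu))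
      fun u hu => congrArg Prod.snd (hx u hu))
    (card_packets_le hn hMn (by simp))
  obtain ⟨B', hB'⟩ := B.exists_of_coins
  have : Nonempty (Fin Δ') := ⟨⟨0, hΔ⟩⟩
  have : Nonempty (Fin M) := ⟨⟨0, hΔ.trans_le hM⟩⟩
  refine ⟨Fin 1 → Fin n → Fin Δ' × Fin M, inferInstance, inferInstance, B',
    fun G _ hG x hx ρ => ?_⟩
  have hprob := hB G (hG.trans hΔΔ) (fun u => (x u, ρ u)) fun v => by
    simp only [Set.mem_ofPred_eq]
    exact_mod_cast (hx v).trans hL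
  refine (sub_le_sub_left (failure_le (K := 1) (c := c) (by omega) hΔ (hΔ.trans_le hM) hMn
    (by simpa using h)) 1).trans (hprob.trans (uniformProb_mono fun ω hω v => ?_))
  rw [hB', hω v]
  -- The two runs differ only in the decidability instance for adjacency.
  convert rfl

/-- With `M` of order `log n ^ a * X ^ (r + 1)`, which is where `b ≤ r + 1` enters, the requirement
is a polylogarithm times `X ^ (2 * r + 1)` at most `n`. The hypothesis leaves one spare factor `X`.
Either it dominates the polylogarithm, or `X` is itself polylogarithmic and `r = o(log n / log log
n)` makes the whole product at most `n`. -/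
theorem eventually_parameters (C c : ℝ) (a b : ℕ) {r : ℕ → ℕ}
    (hr : (fun n : ℕ => (r n : ℝ)) =o[atTop] fun n : ℕ => Real.log n / Real.log (Real.log n))
    (hb : ∀ᶠ n : ℕ in atTop, r n = 0 ∨ b ≤ r n + 1) :
    ∀ᶠ n : ℕ in atTop, r n ≠ 0 → ∀ X : ℕ, 0 < X →
      (X : ℝ) ^ (2 * r n + 2) ≤ n →
        ∃ M : ℕ, X ≤ M ∧ M ≤ n ∧ |C| * Real.log n ^ a * ((X : ℝ) + 1) ^ b ≤ M ∧
          (3 + c) * Real.log n * ((X : ℝ) ^ r n * M) ≤ n := by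
  have hlog : Tendsto (fun n : ℕ => Real.log n) atTop atTop :=
    Real.tendsto_log_atTop.comp tendsto_natCast_atTop_atTop
  -- One unit of the `2` absorbs the summand `X` of `M`, the other the rounding up; `2 ^ b` comes
  -- from `X + 1 ≤ 2 * X`.
  set C₁ : ℝ := 2 + |C| * 2 ^ b with hC₁
  have hC₁2 : 2 ≤ C₁ := by
    have : 0 ≤ |C| * 2 ^ b := by positivity
    linarith
  -- The little-o constant is chosen so that `(a + 2) * (2 * r + 2) * log (log n) ≤ log n`, using `2
  -- * r + 2 ≤ 4 * r` for `r ≥ 1`.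
  have ha : (0 : ℝ) < 1 / (4 * (a + 2)) := by positivity
  filter_upwards [hb, hr.bound ha, hlog.eventually_ge_atTop ((3 + |c|) * C₁), eventually_gt_atTop 0]
    with n hbn hrn hl hn hr0 X hX hXn
  have hb' : b ≤ r n + 1 := hbn.resolve_left hr0
  set l := Real.log n with hl_def
  have hc : 0 ≤ |c| := abs_nonneg c
  have hl6 : 6 ≤ l := by nlinarith
  have hl1 : 1 ≤ l := by linarith
  have hX1 : (1 : ℝ) ≤ X := by exact_mod_cast hX
  have hla : 1 ≤ l ^ a := one_le_pow₀ hl1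
  have hll : 0 < Real.log l := Real.log_pos (by linarith)
  have hn' : (0 : ℝ) < n := by exact_mod_cast hn
  have hP : 1 ≤ l ^ a * (X : ℝ) ^ (r n + 1) := one_le_mul_of_one_le_of_one_le hla (one_le_pow₀ hX1)
  have hXP : (X : ℝ) ≤ l ^ a * (X : ℝ) ^ (r n + 1) := by
    calc (X : ℝ) = 1 * (X : ℝ) ^ 1 := by ring
      _ ≤ _ := by
        gcongr
        omega
  have hLP : |C| * l ^ a * ((X : ℝ) + 1) ^ b ≤ |C| * 2 ^ b * (l ^ a * (X : ℝ) ^ (r n + 1)) := by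
    calc |C| * l ^ a * ((X : ℝ) + 1) ^ b ≤ |C| * l ^ a * (2 * X) ^ b := by
          gcongr
          linarith
      _ = |C| * 2 ^ b * (l ^ a * (X : ℝ) ^ b) := by
          rw [mul_pow]
          ring
      _ ≤ _ := by
          gcongr
  have hL0 : 0 ≤ |C| * l ^ a * ((X : ℝ) + 1) ^ b := by positivity
  set M : ℕ := X + ⌈|C| * l ^ a * ((X : ℝ) + 1) ^ b⌉₊ with hM
  have hMle : (M : ℝ) ≤ C₁ * (l ^ a * (X : ℝ) ^ (r n + 1)) := by
    have := (Nat.ceil_lt_add_one hL0).le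
    rw [hM, hC₁]
    push_cast
    linarith
  have hLM : |C| * l ^ a * ((X : ℝ) + 1) ^ b ≤ M := by
    have := Nat.le_ceil (|C| * l ^ a * ((X : ℝ) + 1) ^ b)
    rw [hM]
    push_cast
    linarith
  have hB : (3 + |c|) * C₁ * l ^ (a + 1) * (X : ℝ) ^ (2 * r n + 1) ≤ n := by
    -- The dichotomy: the spare factor `X` beats the polylogarithm, or `X ≤ l ^ (a + 2)`.
    rcases le_total ((3 + |c|) * C₁ * l ^ (a + 1)) X with h | h
    · calc _ ≤ (X : ℝ) * (X : ℝ) ^ (2 * r n + 1) := by gcongr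
        _ = (X : ℝ) ^ (2 * r n + 2) := by ring
        _ ≤ n := hXn
    · have hB' : (3 + |c|) * C₁ * l ^ (a + 1) ≤ l ^ (a + 2) := by
        calc _ ≤ l * l ^ (a + 1) := by gcongr
          _ = _ := by ring
      have hexp : ((a : ℝ) + 2) * (2 * r n + 2) * Real.log l ≤ l := by
        rw [Real.norm_of_nonneg (by positivity), Real.norm_of_nonneg (by positivity),
          div_mul_div_comm, one_mul, le_div_iff₀ (by positivity)] at hrn
        have hr1 : (1 : ℝ) ≤ r n := by exact_mod_cast Nat.pos_of_ne_zero hr0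
        calc _ ≤ ((a : ℝ) + 2) * (4 * r n) * Real.log l := by
              gcongr
              linarith
          _ ≤ l := by linarith
      calc (3 + |c|) * C₁ * l ^ (a + 1) * (X : ℝ) ^ (2 * r n + 1)
          ≤ l ^ (a + 2) * (l ^ (a + 2)) ^ (2 * r n + 1) := by
            gcongr
            exact h.trans hB'
        _ = l ^ ((a + 2) * (2 * r n + 2)) := by ring
        _ = Real.exp (((a : ℝ) + 2) * (2 * r n + 2) * Real.log l) := by
            rw [← Real.rpow_natCast, Real.rpow_def_of_pos (by linarith)]
            congr 1
            push_cast
            ring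
        _ ≤ Real.exp l := by gcongr
        _ = n := Real.exp_log hn'
  have hmain : (3 + |c|) * l * ((X : ℝ) ^ r n * M) ≤ n := by
    calc (3 + |c|) * l * ((X : ℝ) ^ r n * M)
        ≤ (3 + |c|) * l * ((X : ℝ) ^ r n * (C₁ * (l ^ a * (X : ℝ) ^ (r n + 1)))) := by gcongr
      _ = (3 + |c|) * C₁ * l ^ (a + 1) * (X : ℝ) ^ (2 * r n + 1) := by ring
      _ ≤ n := hB
  refine ⟨M, by omega, ?_, hLM, ?_⟩
  · have : (M : ℝ) ≤ n := by
      calc (M : ℝ) = 1 * 1 * (1 * M) := by ring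
        _ ≤ (3 + |c|) * l * ((X : ℝ) ^ r n * M) := by
          gcongr
          · linarith
          · exact one_le_pow₀ hX1
        _ ≤ n := hmain
    exact_mod_cast this
  · refine le_trans ?_ hmain
    gcongr
    exact le_abs_self c

end Simulation

theorem mainTheorem9 :
    -- Opportunistic routing
    (∃ (R : ℕ) (κ : ℝ), 0 < κ ∧
      ∀ c : ℝ, 1 ≤ c → ∀ n Δ r : ℕ,
        (Δ : ℝ) ^ (2 * (r + 1)) * (((r : ℝ) + 1) * Real.log Δ + c * Real.log n) ≤ n →
          LearnsHopEdges n Δ r R ((n : ℝ) ^ (-(κ * c)))) ∧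
    -- Simulation of LOCAL algorithms
    (∀ (C c : ℝ) (a b : ℕ), ∃ R : ℕ,
      ∀ r : ℕ → ℕ,
        (fun n : ℕ => (r n : ℝ)) =o[atTop]
          (fun n : ℕ => Real.log n / Real.log (Real.log n)) →
        (∀ᶠ n : ℕ in atTop, r n = 0 ∨ b ≤ r n + 1) →
          ∀ᶠ n : ℕ in atTop, ∀ Δ : ℕ,
            (Δ : ℝ) ≤ (n : ℝ) ^ (1 / (2 * (r n : ℝ) + 2)) →
              ∀ (t : ℕ) (Out : Type) (A : LocalAlg n t Out),
                SimulatesLocal A (r n) Δ (C * Real.log n ^ a * ((Δ : ℝ) + 1) ^ b) R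
                  ((n : ℝ) ^ (-c))) := by
  refine ⟨⟨112, 1, one_pos, fun c hc n Δ r h => ?_⟩, fun C c a b => ⟨28, fun r hr hb => ?_⟩⟩
  · rw [one_mul]
    exact learnsHopEdges_of_le hc h
  · filter_upwards [eventually_parameters C c a b hr hb, eventually_ge_atTop 2]
      with n hn hn2 Δ hΔ t Out A
    rcases eq_or_ne (r n) 0 with h0 | h0
    · rw [h0]
      exact simulatesLocal_zero A Δ _ _ (by positivity)
    · have hn1 : (1 : ℝ) ≤ n := by exact_mod_cast (by omega : 1 ≤ n)
      -- Replacing `Δ` by `max Δ 1` keeps the pointer range nonempty for `Δ = 0`.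
      have hX : ((max Δ 1 : ℕ) : ℝ) ^ (2 * r n + 2) ≤ n := by
        have h1 : ((max Δ 1 : ℕ) : ℝ) ≤ (n : ℝ) ^ (1 / (2 * (r n : ℝ) + 2)) := by
          rw [Nat.cast_max, max_le_iff]
          exact ⟨hΔ, by simpa using Real.one_le_rpow hn1 (by positivity)⟩
        calc ((max Δ 1 : ℕ) : ℝ) ^ (2 * r n + 2)
            ≤ ((n : ℝ) ^ (1 / (2 * (r n : ℝ) + 2))) ^ (2 * r n + 2) := by gcongr
          _ = n := by
            rw [← Real.rpow_natCast, ← Real.rpow_mul (by positivity)]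
            push_cast
            rw [one_div, inv_mul_cancel₀ (by positivity), Real.rpow_one]
      obtain ⟨M, hM1, hM2, hM3, hM4⟩ := hn h0 (max Δ 1) (by omega) hX
      refine simulatesLocal_of_le A hn2 (by omega) (le_max_left _ _) hM1 hM2 (le_trans ?_ hM3) hM4
      have hl : 0 ≤ Real.log n := Real.log_nonneg hn1
      gcongr
      · exact le_abs_self C
      · exact le_max_left _ _
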